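/- A hypergraph $H=(V,E)$ is a finite set $V$ of vertices with a set $E$ of subsets of $V$, the edges. A nonempty edge is monochromatic under a colouring of the vertices if all its vertices have the same colour (the empty set, if it is an edge, is never monochromatic). For $S\subseteq V$, the induced hypergraph $H[S]$ has vertex set $S$ and edge set $\{e\in E : e\subseteq S\}$. A hypergraph is $2$-colourable if its vertices can be coloured with two colours so that no edge is monochromatic. The colourability defect $\mathrm{cd}(H)$ is the minimum of $|R|$ over all $R\subseteq V$ such that $H[V\setminus R]$ is $2$-colourable. The generalized Kneser graph $\mathrm{KG}(H)$ is the simple graph with vertex set $E$ in which two distinct edges $e,f\in E$ are adjacent if and only if $e\cap f=\varnothing$. Theorem (Dol'nikov). For every hypergraph $H$, the chromatic number of $\mathrm{KG}(H)$ is at least $\mathrm{cd}(H)$. -/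

import Mathlib

namespace KneserHypergraph

/-- The hypergraph `H[S]` induced by `H` on `S`: its vertex set is `S`, and its edges are the
edges of `H` that are contained in `S`. -/
def induce {α : Type*} (H : Hypergraph α) (S : Set α) : Hypergraph α where
  vertexSet := S
  edgeSet := {e | e ∈ H.edgeSet ∧ e ⊆ S}
  subset_vertexSet_of_mem_edgeSet' := fun _ he => he.2

/-- The set `e` of vertices is monochromatic under the colouring `c`: it has a vertex, and all its
vertices have the same colour. (The empty set has no colour.) -/
def IsMonochromatic {α κ : Type*} (c : α → κ) (e : Set α) : Prop :=
  e.Nonempty ∧ ∃ k : κ, ∀ v ∈ e, c v = k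

/-- `H` is `2`-colourable: its vertices can be coloured with two colours so that no edge is
monochromatic. (The colours of points outside the vertex set play no role, because edges are
contained in the vertex set.) -/
def IsTwoColorable {α : Type*} (H : Hypergraph α) : Prop :=
  ∃ c : α → Fin 2, ∀ e ∈ H.edgeSet, ¬ IsMonochromatic c e

/-- The generalized Kneser graph `KG(H)`: its vertices are the edges of `H`, and two different
edges of `H` are adjacent when they are disjoint. -/
def generalizedKneserGraph {α : Type*} (H : Hypergraph α) : SimpleGraph H.edgeSet where
  Adj e f := e ≠ f ∧ (e : Set α) ∩ (f : Set α) = ∅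
  symm := ⟨fun _ _ h => ⟨h.1.symm, (Set.inter_comm _ _).trans h.2⟩⟩
  loopless := ⟨fun _ h => h.1 rfl⟩

/-- The possible sizes of a finite set `R` of vertices of `H` whose removal leaves a
`2`-colourable hypergraph (edges that meet `R` are discarded). -/
def removalSizes {α : Type*} (H : Hypergraph α) : Set ℕ :=
  {m | ∃ R : Finset α, (R : Set α) ⊆ H.vertexSet ∧ R.card = m ∧
    IsTwoColorable (induce H (H.vertexSet \ (R : Set α)))}

/-- The colourability defect `cd(H)`: the least number of vertices that have to be removed from `H`
to leave a `2`-colourable hypergraph. -/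
noncomputable def colorabilityDefect {α : Type*} (H : Hypergraph α) : ℕ :=
  sInf (removalSizes H)

/-- If the vertex set is finite, the colourability defect is an attained minimum. -/
theorem colorabilityDefect_mem {α : Type*} (H : Hypergraph α) (hV : H.vertexSet.Finite) :
    colorabilityDefect H ∈ removalSizes H := by
  apply Nat.sInf_mem
  refine ⟨_, hV.toFinset, by simp, rfl, fun _ => 0, ?_⟩
  rintro e ⟨-, he⟩ ⟨⟨v, hv⟩, -⟩
  simpa using he hv

end KneserHypergraph

/-! Given an `m`-colouring of `KG(H)`, attach to each nonzero sign vector `X` on the vertex set `V`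
the colours of the nonempty edges inside its positive part and those inside its negative part. Edges
in opposite parts are disjoint, so no colour occurs on both sides. If no colour occurs, the two
parts 2-colour what remains after deleting the zero set, so `X` has at most `r = |V| - cd(H)`
nonzero entries. Label such `X` by its size and every other `X` by its largest colour, shifted past
the sizes, with signs that make the labelling antipodal. It has `r + m` label numbers and no
complementary labels on comparable vectors, so Tucker's lemma gives `|V| ≤ r + m`, that is, `cd(H) ≤
m`.

Tucker's lemma follows from Fan's parity theorem (`sum_flags_altSort`): an odd number of maximal
chains carry alternating labels, and such labels have distinct numbers. The parity is proved by
induction on dimension: the count over the sphere becomes a count of alternating facets over a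
hemisphere, where interior facets cancel in pairs and the equator remains. -/

namespace KneserHypergraph

/-! ### Alternating sign lists modulo 2 -/

/-- The indicator of a list of signs that alternates and starts with `c` (if it is nonempty). -/
def alt : Bool → List Bool → ZMod 2
  | _, [] => 1
  | c, x :: l => if x = c then alt (!c) l else 0

/-- The local count in Fan's argument. If the head is `c`, the tail alternating from `c` arises both
by erasing the head and from the induction hypothesis, and cancels modulo 2; otherwise only erasing
the head can contribute. -/
theorem sum_alt_eraseIdx (l : List Bool) (c : Bool) :
    ∑ i ∈ Finset.range l.length, alt c (l.eraseIdx i) = alt c l + alt (!c) l := by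
  induction l generalizing c with
  | nil => simp only [List.length_nil, Finset.range_zero, Finset.sum_empty, alt]; decide
  | cons x l ih =>
    rw [List.length_cons, Finset.sum_range_succ']
    simp only [List.eraseIdx_cons_succ, List.eraseIdx_zero, List.tail_cons, alt]
    by_cases h : x = c
    · have h' : x ≠ !c := by rw [h]; cases c <;> decide
      simp only [if_pos h, if_neg h', ih, Bool.not_not, add_assoc, CharTwo.add_self_eq_zero]
    · have h' : x = !c := by revert h; cases c <;> cases x <;> decide
      simp only [if_neg h, if_pos h', Finset.sum_const_zero, Bool.not_not]

theorem alt_not_map (l : List Bool) (c : Bool) : alt c (l.map not) = alt (!c) l := by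
  induction l generalizing c with
  | nil => rfl
  | cons x l ih =>
    simp only [List.map_cons, alt, ih]
    cases c <;> cases x <;> rfl

theorem isChain_ne_of_alt_ne_zero (l : List Bool) (c : Bool) (h : alt c l ≠ 0) :
    l.IsChain (· ≠ ·) := by
  induction l generalizing c with
  | nil => exact .nil
  | cons x l ih =>
    have hx : x = c := by by_contra hx; simp [alt, hx] at h
    subst hx
    simp only [alt, if_true] at h
    cases l with
    | nil => simp
    | cons y l =>
      have hy : y = !x := by by_contra hy; simp [alt, hy] at h
      refine List.isChain_cons_cons.2 ⟨?_, ih _ h⟩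
      rw [hy]; cases x <;> decide

/-! ### Signed labels, sorted by number -/

/-- Signed labels: a natural number with a sign. -/
abbrev Label := ℕ ×ₗ Bool

/-- The sign of a label. -/
def Label.sign (a : Label) : Bool := (ofLex a).2

/-- The number of a label. -/
def Label.index (a : Label) : ℕ := (ofLex a).1

/-- The label of opposite sign. -/
def Label.neg (a : Label) : Label := toLex (a.index, !a.sign)

/-- The indicator of a multiset of labels whose signs alternate and start with `c` when the labels
are sorted. -/
noncomputable def altSort (c : Bool) (M : Multiset Label) : ZMod 2 :=
  alt c ((M.sort (· ≤ ·)).map Label.sign)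

theorem map_sum_altSort_erase (M : Multiset Label) (c : Bool) :
    (M.map fun a => altSort c (M.erase a)).sum = altSort c M + altSort (!c) M := by
  have key : ∀ l : List Label, l.Pairwise (· ≤ ·) →
      ((l : Multiset Label).map fun a => altSort c ((l : Multiset Label).erase a)).sum =
        alt c (l.map Label.sign) + alt (!c) (l.map Label.sign) := by
    intro l hl
    rw [← sum_alt_eraseIdx, List.length_map, Multiset.map_coe, Multiset.sum_coe,
      ← Fin.sum_univ_fun_getElem l, Finset.sum_range]
    refine Finset.sum_congr rfl fun i _ => ?_
    have h1 : ((l : Multiset Label).erase l[i]).sort (· ≤ ·) = l.eraseIdx i := by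
      refine List.Perm.eq_of_pairwise' (r := (· ≤ ·)) (Multiset.pairwise_sort _ _)
        (hl.sublist (List.eraseIdx_sublist _ _)) ?_
      rw [← Multiset.coe_eq_coe, Multiset.sort_eq,
        ← Multiset.coe_eq_coe.2 (List.getElem_cons_eraseIdx_perm i.2), ← Multiset.cons_coe]
      exact Multiset.erase_cons_head _ _
    rw [List.eraseIdx_map]
    exact congrArg (fun l => alt c (l.map Label.sign)) h1
  have := key (M.sort (· ≤ ·)) (Multiset.pairwise_sort _ _)
  rwa [Multiset.sort_eq] at this

theorem sum_altSort_succAbove {k : ℕ} (f : Fin (k + 1) → Label) (c : Bool) :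
    ∑ i : Fin (k + 1), altSort c (Finset.univ.val.map fun j => f (i.succAbove j)) =
      altSort c (Finset.univ.val.map f) + altSort (!c) (Finset.univ.val.map f) := by
  rw [← map_sum_altSort_erase, Multiset.map_map]
  refine Finset.sum_congr rfl fun i _ => ?_
  have : Finset.univ.val.map f = f i ::ₘ Finset.univ.val.map fun j => f (i.succAbove j) := by
    rw [Fin.univ_succAbove k i, Finset.cons_val, Multiset.map_cons, Finset.map_val,
      Multiset.map_map]
    rfl
  rw [Function.comp_apply, this, Multiset.erase_cons_head]

/-- Without complementary pairs, labels with equal numbers are equal, so negation preserves the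
sorted order and only flips the signs. -/
theorem altSort_map_neg (M : Multiset Label) (hM : ∀ a ∈ M, ∀ b ∈ M, a ≠ b.neg) (c : Bool) :
    altSort c (M.map Label.neg) = altSort (!c) M := by
  have h : (M.map Label.neg).sort (· ≤ ·) = (M.sort (· ≤ ·)).map Label.neg := by
    refine List.Perm.eq_of_pairwise' (r := (· ≤ ·)) (Multiset.pairwise_sort _ _) ?_ ?_
    · rw [List.pairwise_map]
      refine (Multiset.pairwise_sort M (· ≤ ·)).imp_of_mem fun {a b} ha hb hab => ?_
      rw [Multiset.mem_sort] at ha hb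
      rcases Prod.Lex.le_iff.1 hab with h | ⟨h1, -⟩
      · exact Prod.Lex.le_iff.2 (Or.inl h)
      · have h2 : (ofLex a).2 = (ofLex b).2 := by
          by_contra h2
          refine hM a ha b hb (ofLex.injective (Prod.ext h1 ?_))
          change (ofLex a).2 = !(ofLex b).2
          revert h2; cases (ofLex a).2 <;> cases (ofLex b).2 <;> decide
        rw [show a = b from ofLex.injective (Prod.ext h1 h2)]
    · rw [← Multiset.coe_eq_coe, Multiset.sort_eq, ← Multiset.map_coe, Multiset.sort_eq]
  rw [altSort, h, altSort, ← alt_not_map, List.map_map, List.map_map]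
  rfl

/-- If the signs of a multiset of labels without complementary pairs alternate, then the labels
have different numbers. -/
theorem nodup_index_of_altSort_ne_zero (M : Multiset Label)
    (hM : ∀ a ∈ M, ∀ b ∈ M, a ≠ b.neg) (c : Bool) (h : altSort c M ≠ 0) :
    (M.map Label.index).Nodup := by
  have h1 := List.isChain_map _ |>.1 (isChain_ne_of_alt_ne_zero _ _ h)
  have h2 : (M.sort (· ≤ ·)).IsChain (fun a b => a.index < b.index) := by
    have h3 := (Multiset.pairwise_sort M (· ≤ ·)).isChain
    have h4 : ∀ a ∈ M.sort (· ≤ ·), a ∈ M := fun a ha => (Multiset.mem_sort _).1 ha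
    generalize M.sort (· ≤ ·) = l at h1 h3 h4
    rw [List.isChain_iff_getElem] at h1 h3 ⊢
    intro i hi
    rcases Prod.Lex.le_iff.1 (h3 i hi) with h | ⟨h, -⟩
    · exact h
    · refine absurd ?_ (hM l[i] (h4 _ (List.getElem_mem _)) l[i + 1] (h4 _ (List.getElem_mem hi)))
      refine ofLex.injective (Prod.ext h ?_)
      have := h1 i hi
      change (l[i]).sign = !(l[i + 1]).sign
      revert this; cases (l[i]).sign <;> cases (l[i + 1]).sign <;> decide
  have h5 : ((M.sort (· ≤ ·)).map Label.index).Pairwise (· < ·) :=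
    List.isChain_iff_pairwise.1 ((List.isChain_map _).2 h2)
  rw [← Multiset.sort_eq M (· ≤ ·), Multiset.map_coe]
  exact Multiset.coe_nodup.2 (h5.imp fun h => h.ne)

/-! ### Sign vectors and their chains -/

/-- The antipode of a signed element. -/
def signFlip {α : Type*} (x : α × Bool) : α × Bool := (x.1, !x.2)

theorem signFlip_signFlip {α : Type*} (x : α × Bool) : signFlip (signFlip x) = x := by
  simp [signFlip]

theorem signFlip_injective {α : Type*} : Function.Injective (signFlip (α := α)) :=
  Function.LeftInverse.injective signFlip_signFlip

theorem mem_image_signFlip {α : Type*} [DecidableEq α] {X : Finset (α × Bool)} {v : α} {b : Bool} :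
    (v, b) ∈ X.image signFlip ↔ (v, !b) ∈ X := by
  rw [Finset.mem_image]
  constructor
  · rintro ⟨x, hx, h⟩
    rwa [← signFlip_signFlip x, h] at hx
  · exact fun h => ⟨_, h, signFlip_signFlip (v, b)⟩

/-- `X` encodes a nonzero sign vector on the ground set `S`: the elements of sign `b` are the `a`
with `(a, b) ∈ X`. -/
structure IsSignVector {α : Type*} (S : Finset α) (X : Finset (α × Bool)) : Prop where
  nonempty : X.Nonempty
  fst_mem : ∀ x ∈ X, x.1 ∈ S
  injOn : Set.InjOn Prod.fst (X : Set (α × Bool))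

theorem IsSignVector.mono {α : Type*} {S T : Finset α} {X : Finset (α × Bool)}
    (hX : IsSignVector S X) (h : S ⊆ T) : IsSignVector T X :=
  ⟨hX.nonempty, fun x hx => h (hX.fst_mem x hx), hX.injOn⟩

theorem Label.neg_neg (a : Label) : a.neg.neg = a := by
  refine ofLex.injective (Prod.ext rfl ?_)
  exact Bool.not_not _

/-- Signed sequences of `k` different elements of `S`. They encode the chains of `k` sign vectors
with supports of sizes `1, …, k`. -/
noncomputable def flags {α : Type*} [DecidableEq α] (S : Finset α) (k : ℕ) : Finset (Fin k → α × Bool) :=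
  (Fintype.piFinset fun _ => S ×ˢ Finset.univ).filter fun p => Function.Injective fun i => (p i).1

theorem mem_flags {α : Type*} [DecidableEq α] {S : Finset α} {k : ℕ} {p : Fin k → α × Bool} :
    p ∈ flags S k ↔ (∀ i, (p i).1 ∈ S) ∧ Function.Injective fun i => (p i).1 := by
  simp [flags, Fintype.mem_piFinset]

/-- The `i`-th sign vector of the chain encoded by `p`. -/
noncomputable def prefixSet {α : Type*} [DecidableEq α] {k : ℕ} (p : Fin k → α × Bool) (i : Fin k) :
    Finset (α × Bool) := (Finset.Iic i).image p

theorem mem_prefixSet {α : Type*} [DecidableEq α] {k : ℕ} {p : Fin k → α × Bool} {i : Fin k} {x : α × Bool} :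
    x ∈ prefixSet p i ↔ ∃ j ≤ i, p j = x := by
  simp [prefixSet]

theorem prefixSet_mono {α : Type*} [DecidableEq α] {k : ℕ} (p : Fin k → α × Bool) : Monotone (prefixSet p) := by
  intro i j hij x hx
  obtain ⟨l, hl, rfl⟩ := mem_prefixSet.1 hx
  exact mem_prefixSet.2 ⟨l, hl.trans hij, rfl⟩

theorem isSignVector_prefixSet {α : Type*} [DecidableEq α] {S : Finset α} {k : ℕ} {p : Fin k → α × Bool}
    (hp : p ∈ flags S k) (i : Fin k) : IsSignVector S (prefixSet p i) := by
  rw [mem_flags] at hp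
  refine ⟨⟨p i, mem_prefixSet.2 ⟨i, le_rfl, rfl⟩⟩, ?_, ?_⟩
  · intro x hx
    obtain ⟨j, -, rfl⟩ := mem_prefixSet.1 hx
    exact hp.1 j
  · intro x hx y hy hxy
    obtain ⟨j, -, rfl⟩ := mem_prefixSet.1 hx
    obtain ⟨l, -, rfl⟩ := mem_prefixSet.1 hy
    rw [hp.2 hxy]

/-- Only the prefix that ends between the two swapped entries can tell them apart. -/
theorem prefixSet_comp_swap {α : Type*} [DecidableEq α] {k : ℕ} (p : Fin (k + 1) → α × Bool) (i : Fin k)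
    {j : Fin (k + 1)} (hj : j ≠ i.castSucc) :
    prefixSet (p ∘ Equiv.swap i.castSucc i.succ) j = prefixSet p j := by
  have h : ∀ x, Equiv.swap i.castSucc i.succ x ≤ j ↔ x ≤ j := by
    intro x
    have h1 : i.castSucc ≤ j ↔ i.succ ≤ j := by
      rw [Ne, Fin.ext_iff] at hj
      simp only [Fin.le_def, Fin.val_castSucc, Fin.val_succ] at hj ⊢
      omega
    by_cases h2 : x = i.castSucc
    · rw [h2, Equiv.swap_apply_left, h1]
    by_cases h3 : x = i.succ
    · rw [h3, Equiv.swap_apply_right, h1]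
    rw [Equiv.swap_apply_of_ne_of_ne h2 h3]
  ext x
  rw [mem_prefixSet, mem_prefixSet]
  constructor
  · rintro ⟨l, hl, rfl⟩
    exact ⟨_, (h l).2 hl, rfl⟩
  · rintro ⟨l, hl, rfl⟩
    exact ⟨Equiv.swap i.castSucc i.succ l, (h l).2 hl, by simp⟩

theorem prefixSet_castSucc {α : Type*} [DecidableEq α] {k : ℕ} (p : Fin (k + 1) → α × Bool) (j : Fin k) :
    prefixSet p j.castSucc = prefixSet (Fin.init p) j := by
  ext x
  rw [mem_prefixSet, mem_prefixSet]
  constructor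
  · rintro ⟨l, hl, rfl⟩
    have hl' : (l : ℕ) < k := lt_of_le_of_lt hl j.2
    exact ⟨⟨l, hl'⟩, hl, rfl⟩
  · rintro ⟨l, hl, rfl⟩
    exact ⟨l.castSucc, hl, rfl⟩

theorem prefixSet_signFlip_comp {α : Type*} [DecidableEq α] {k : ℕ} (p : Fin k → α × Bool) (j : Fin k) :
    prefixSet (signFlip ∘ p) j = (prefixSet p j).image signFlip := by
  rw [prefixSet, prefixSet, Finset.image_image]

/-- The labels of the chain encoded by `p`. -/
noncomputable def flagLabels {α : Type*} [DecidableEq α] (L : Finset (α × Bool) → Label) {k : ℕ}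
    (p : Fin k → α × Bool) : Multiset Label :=
  Finset.univ.val.map fun i => L (prefixSet p i)

theorem flagLabels_ne_neg {α : Type*} [DecidableEq α] {S : Finset α} {L : Finset (α × Bool) → Label}
    (hL : ∀ X Y, IsSignVector S X → IsSignVector S Y → X ⊆ Y → L X ≠ (L Y).neg) {k : ℕ}
    {p : Fin k → α × Bool} (hp : p ∈ flags S k) :
    ∀ a ∈ flagLabels L p, ∀ b ∈ flagLabels L p, a ≠ b.neg := by
  intro a ha b hb hab
  obtain ⟨i, -, rfl⟩ := Multiset.mem_map.1 ha
  obtain ⟨j, -, rfl⟩ := Multiset.mem_map.1 hb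
  rcases le_total i j with h | h
  · exact hL _ _ (isSignVector_prefixSet hp i) (isSignVector_prefixSet hp j)
      (prefixSet_mono p h) hab
  · exact hL _ _ (isSignVector_prefixSet hp j) (isSignVector_prefixSet hp i)
      (prefixSet_mono p h) (by rw [hab, Label.neg_neg])

/-! ### Hemispheres, Fan's parity theorem and Tucker's lemma -/

/-- The chains of `flags S k` that lie in the hemisphere where `v` does not have a negative sign. -/
noncomputable def upperFlags {α : Type*} [DecidableEq α] (S : Finset α) (k : ℕ) (v : α) :
    Finset (Fin k → α × Bool) :=
  (flags S k).filter fun p => ∀ i, p i ≠ (v, false)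

theorem mem_upperFlags {α : Type*} [DecidableEq α] {S : Finset α} {k : ℕ} {v : α} {p : Fin k → α × Bool} :
    p ∈ upperFlags S k v ↔ ((∀ i, (p i).1 ∈ S) ∧ Function.Injective fun i => (p i).1) ∧
      ∀ i, p i ≠ (v, false) := by
  rw [upperFlags, Finset.mem_filter, mem_flags]

theorem comp_swap_mem_upperFlags {α : Type*} [DecidableEq α] {S : Finset α} {k : ℕ} {v : α}
    {p : Fin k → α × Bool} (hp : p ∈ upperFlags S k v) (a b : Fin k) :
    p ∘ Equiv.swap a b ∈ upperFlags S k v := by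
  rw [mem_upperFlags] at hp ⊢
  exact ⟨⟨fun _ => hp.1.1 _, hp.1.2.comp (Equiv.injective _)⟩, fun _ => hp.2 _⟩

/-- The interior facets of the hemisphere obtained by dropping a non-maximal sign vector cancel. -/
theorem sum_upperFlags_castSucc {α : Type*} [DecidableEq α] (S : Finset α) (L : Finset (α × Bool) → Label)
    (k : ℕ) (v : α) (i : Fin k) :
    ∑ p ∈ upperFlags S (k + 1) v, altSort true (Finset.univ.val.map fun j =>
      L (prefixSet p (i.castSucc.succAbove j))) = 0 := by
  -- A facet missing this level lies in exactly two chains, which differ in the order of two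
  -- consecutive entries.
  refine Finset.sum_involution (fun p _ => p ∘ Equiv.swap i.castSucc i.succ) ?_ ?_ ?_ ?_
  · intro p _
    simp only [prefixSet_comp_swap p i (Fin.succAbove_ne _ _)]
    exact CharTwo.add_self_eq_zero _
  · intro p hp _ h
    have h1 := congrArg Prod.fst (congrFun h i.castSucc)
    rw [Function.comp_apply, Equiv.swap_apply_left] at h1
    exact (Fin.castSucc_lt_succ (i := i)).ne' ((mem_upperFlags.1 hp).1.2 h1)
  · exact fun p hp => comp_swap_mem_upperFlags hp _ _
  · intro p _
    ext1 x
    simp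

/-- The facets of the hemisphere obtained by dropping the maximal sign vector cancel, except for
those on the boundary of the hemisphere. -/
theorem sum_upperFlags_last {α : Type*} [DecidableEq α] {S : Finset α}
    (L : Finset (α × Bool) → Label) (k : ℕ) {v : α} (hv : v ∈ S) :
    ∑ p ∈ upperFlags S (k + 1) v, altSort true (Finset.univ.val.map fun j =>
      L (prefixSet p ((Fin.last k).succAbove j))) =
    ∑ p ∈ flags (S.erase v) k, altSort true (flagLabels L p) := by
  simp only [Fin.succAbove_last, prefixSet_castSucc]
  -- Flipping the sign of the last entry keeps all proper prefixes and stays in the hemisphere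
  -- unless that entry is `(v, true)`; the exceptions are the boundary facets.
  rw [← Finset.sum_filter_add_sum_filter_not _ (fun p => p (Fin.last k) = (v, true))]
  have h2 : ∑ p ∈ (upperFlags S (k + 1) v).filter (fun p => ¬ p (Fin.last k) = (v, true)),
      altSort true (Finset.univ.val.map fun j => L (prefixSet (Fin.init p) j)) = 0 := by
    have hinit : ∀ p : Fin (k + 1) → α × Bool, ∀ x,
        Fin.init (Function.update p (Fin.last k) x) = Fin.init p :=
      fun p x => Fin.init_update_last (α := fun _ => α × Bool) p x
    refine Finset.sum_involution
      (fun p _ => Function.update p (Fin.last k) (signFlip (p (Fin.last k)))) ?_ ?_ ?_ ?_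
    · intro p _
      simp only [hinit]
      exact CharTwo.add_self_eq_zero _
    · intro p _ _ h
      have h1 := congrArg Prod.snd (congrFun h (Fin.last k))
      simp [signFlip] at h1
    · intro p hp
      rw [Finset.mem_filter, mem_upperFlags] at hp ⊢
      have hfst : ∀ i, (Function.update p (Fin.last k) (signFlip (p (Fin.last k))) i).1 =
          (p i).1 := by
        intro i
        by_cases hi : i = Fin.last k
        · rw [hi, Function.update_self]; rfl
        · rw [Function.update_of_ne hi]
      simp only [hfst]
      refine ⟨⟨hp.1.1, fun i hi => ?_⟩, fun h => ?_⟩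
      · by_cases hi' : i = Fin.last k
        · rw [hi', Function.update_self] at hi
          exact hp.2 (by rw [← signFlip_signFlip (p _), hi]; rfl)
        · rw [Function.update_of_ne hi'] at hi
          exact hp.1.2 i hi
      · rw [Function.update_self] at h
        exact hp.1.2 (Fin.last k) (by rw [← signFlip_signFlip (p _), h]; rfl)
    · intro p _
      simp [signFlip_signFlip]
  rw [h2, add_zero]
  refine Finset.sum_nbij' Fin.init (fun q => Fin.snoc q (v, true)) ?_ ?_ ?_ ?_ ?_
  · intro p hp
    rw [Finset.mem_filter, mem_upperFlags] at hp
    refine mem_flags.2 ⟨fun i => Finset.mem_erase.2 ⟨fun h => ?_, hp.1.1.1 _⟩,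
      hp.1.1.2.comp (Fin.castSucc_injective k)⟩
    refine (Fin.castSucc_lt_last i).ne (hp.1.1.2 ?_)
    change (p i.castSucc).1 = (p (Fin.last k)).1
    rw [hp.2]; exact h
  · intro q hq
    obtain ⟨hq1, hq2⟩ := mem_flags.1 hq
    have hne : ∀ i, (q i).1 ≠ v := fun i => (Finset.mem_erase.1 (hq1 i)).1
    rw [Finset.mem_filter, mem_upperFlags]
    refine ⟨⟨⟨?_, ?_⟩, ?_⟩, Fin.snoc_last _ _⟩
    · intro i
      induction i using Fin.lastCases with
      | last => simpa using hv
      | cast i => simpa using (Finset.mem_erase.1 (hq1 i)).2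
    · intro i j hij
      induction i using Fin.lastCases with
      | last =>
        induction j using Fin.lastCases with
        | last => rfl
        | cast j => simp at hij; exact absurd hij.symm (hne j)
      | cast i =>
        induction j using Fin.lastCases with
        | last => simp at hij; exact absurd hij (hne i)
        | cast j => simp at hij; rw [hq2 hij]
    · intro i h
      induction i using Fin.lastCases with
      | last => simp at h
      | cast i => simp at h; exact hne i (by rw [h])
  · intro p hp
    rw [← (Finset.mem_filter.1 hp).2]
    exact Fin.snoc_init_self p
  · intro q _
    exact Fin.init_snoc (α := fun _ => α × Bool) _ _
  · intro p _
    rfl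

/-- Reflection exchanges the two hemispheres, and the two signs of the labels. -/
theorem sum_flags_eq_upperFlags {α : Type*} [DecidableEq α] {S : Finset α}
    {L : Finset (α × Bool) → Label}
    (hneg : ∀ X, IsSignVector S X → L (X.image signFlip) = (L X).neg)
    (hL : ∀ X Y, IsSignVector S X → IsSignVector S Y → X ⊆ Y → L X ≠ (L Y).neg) {v : α}
    (hv : v ∈ S) {k : ℕ} (hk : S.card = k) :
    ∑ p ∈ flags S k, altSort true (flagLabels L p) =
      ∑ p ∈ upperFlags S k v, (altSort true (flagLabels L p) + altSort false (flagLabels L p)) := by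
  rw [Finset.sum_add_distrib, ← Finset.sum_filter_add_sum_filter_not (flags S k)
    (fun p => ∀ i, p i ≠ (v, false))]
  congr 1
  have hflip : ∀ p ∈ flags S k, signFlip ∘ p ∈ flags S k := fun p hp =>
    mem_flags.2 ⟨(mem_flags.1 hp).1, (mem_flags.1 hp).2⟩
  -- Chains of full length use every element, so `v` has a sign and each chain lies in exactly one
  -- hemisphere.
  have hsurj : ∀ p ∈ flags S k, ∃ i, (p i).1 = v := by
    intro p hp
    obtain ⟨hp1, hp2⟩ := mem_flags.1 hp
    have : Finset.univ.image (fun i => (p i).1) = S := by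
      refine Finset.eq_of_subset_of_card_le (Finset.image_subset_iff.2 fun i _ => hp1 i) ?_
      rw [Finset.card_image_of_injective _ hp2, Finset.card_univ, Fintype.card_fin, hk]
    rw [← this] at hv
    obtain ⟨i, -, hi⟩ := Finset.mem_image.1 hv
    exact ⟨i, hi⟩
  have hinv : ∀ p : Fin k → α × Bool, signFlip ∘ (signFlip ∘ p) = p := fun p =>
    funext fun i => signFlip_signFlip _
  refine Finset.sum_nbij' (fun p => signFlip ∘ p) (fun p => signFlip ∘ p) ?_ ?_ ?_ ?_ ?_
  · intro p hp
    rw [Finset.mem_filter] at hp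
    obtain ⟨hp, h⟩ := hp
    push Not at h
    obtain ⟨i, hi⟩ := h
    refine mem_upperFlags.2 ⟨mem_flags.1 (hflip p hp), fun j hj => ?_⟩
    have h1 : p j = (v, true) := by
      rw [← signFlip_signFlip (p j)]
      exact congrArg signFlip hj
    have h2 : j = i := (mem_flags.1 hp).2 (by simp only [h1, hi])
    rw [h2, hi] at h1
    simp at h1
  · intro p hp
    rw [upperFlags, Finset.mem_filter] at hp
    rw [Finset.mem_filter]
    refine ⟨hflip p hp.1, fun h => ?_⟩
    obtain ⟨i, hi⟩ := hsurj p hp.1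
    have h1 := hp.2 i
    have h2 := h i
    rw [Function.comp_apply] at h2
    rcases hpi : p i with ⟨w, b⟩
    rw [hpi] at hi h1 h2
    subst hi
    cases b
    · exact h1 rfl
    · exact h2 rfl
  · exact fun p _ => hinv p
  · exact fun p _ => hinv p
  · intro p hp
    have hp := (Finset.mem_filter.1 hp).1
    rw [← Bool.not_true, ← altSort_map_neg _ (flagLabels_ne_neg hL (hflip p hp)), flagLabels,
      flagLabels, Multiset.map_map]
    congr 1
    refine Multiset.map_congr rfl fun i _ => ?_
    rw [Function.comp_apply, ← hneg _ (isSignVector_prefixSet (hflip p hp) i)]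
    congr 1
    ext x
    rw [prefixSet_signFlip_comp, Finset.image_image]
    simp [Function.comp_def, signFlip_signFlip]

/-- **Ky Fan's parity theorem** for the barycentric subdivision of the cross-polytope: the number of
maximal chains of sign vectors with alternating labels, the smallest positive, is odd. -/
theorem sum_flags_altSort {α : Type*} [DecidableEq α] (L : Finset (α × Bool) → Label) (k : ℕ)
    (S : Finset α) (hk : S.card = k)
    (hneg : ∀ X, IsSignVector S X → L (X.image signFlip) = (L X).neg)
    (hL : ∀ X Y, IsSignVector S X → IsSignVector S Y → X ⊆ Y → L X ≠ (L Y).neg) :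
    ∑ p ∈ flags S k, altSort true (flagLabels L p) = 1 := by
  induction k generalizing S with
  | zero =>
    have h : flags S 0 = Finset.univ :=
      Finset.eq_univ_of_forall fun p => mem_flags.2 ⟨fun i => i.elim0, fun i => i.elim0⟩
    rw [h, Fintype.sum_unique]
    simp [flagLabels, altSort, alt]
  | succ k ih =>
    obtain ⟨v, hv⟩ := Finset.card_pos.1 (hk ▸ k.succ_pos : 0 < S.card)
    have hsub := Finset.erase_subset v S
    rw [sum_flags_eq_upperFlags hneg hL hv hk,
      ← ih (S.erase v) (by rw [Finset.card_erase_of_mem hv, hk]; rfl)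
        (fun X hX => hneg X (hX.mono hsub))
        (fun X Y hX hY => hL X Y (hX.mono hsub) (hY.mono hsub)),
      ← sum_upperFlags_last L k hv]
    have h : ∀ p : Fin (k + 1) → α × Bool,
        altSort true (flagLabels L p) + altSort false (flagLabels L p) =
          ∑ i : Fin (k + 1), altSort true (Finset.univ.val.map fun j =>
            L (prefixSet p (i.succAbove j))) :=
      fun p => (sum_altSort_succAbove (fun i => L (prefixSet p i)) true).symm
    rw [Finset.sum_congr rfl fun p _ => h p, Finset.sum_comm, Fin.sum_univ_castSucc,
      Finset.sum_eq_zero fun i _ => sum_upperFlags_castSucc S L k v i, zero_add]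

/-- **Tucker's lemma** for the barycentric subdivision of the cross-polytope. -/
theorem card_le_of_index_lt {α : Type*} [DecidableEq α] (S : Finset α)
    (L : Finset (α × Bool) → Label) (m : ℕ)
    (hneg : ∀ X, IsSignVector S X → L (X.image signFlip) = (L X).neg)
    (hL : ∀ X Y, IsSignVector S X → IsSignVector S Y → X ⊆ Y → L X ≠ (L Y).neg)
    (hm : ∀ X, IsSignVector S X → (L X).index < m) : S.card ≤ m := by
  obtain ⟨p, hp, h⟩ := Finset.exists_ne_zero_of_sum_ne_zero
    (ne_of_eq_of_ne (sum_flags_altSort L _ S rfl hneg hL) one_ne_zero)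
  have h1 := nodup_index_of_altSort_ne_zero _ (flagLabels_ne_neg hL hp) _ h
  rw [flagLabels, Multiset.map_map, Finset.nodup_map_iff_injOn] at h1
  have h2 := Finset.card_le_card_of_injOn (t := Finset.range m) _
    (fun i _ => Finset.mem_coe.2 (Finset.mem_range.2 (hm _ (isSignVector_prefixSet hp i)))) h1
  simpa using h2

/-! ### From colour sets to a Tucker labelling -/

/-- Suppose that to each sign vector `X` and each sign `b` a set `K X b` of colours in `{0, …, m - 1}`
is attached, monotonically and compatibly with the antipode, so that `K X true` and `K X false` are
disjoint. If all sign vectors without colours have at most `r` nonzero entries, then the ground set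
has at most `r + m` elements. -/
theorem card_le_of_colour_sets {α : Type*} [DecidableEq α] (S : Finset α) (r m : ℕ)
    (K : Finset (α × Bool) → Bool → Set ℕ)
    (hflip : ∀ X b, K (X.image signFlip) b = K X (!b))
    (hmono : ∀ X Y b, X ⊆ Y → K X b ⊆ K Y b)
    (hlt : ∀ X b, ∀ k ∈ K X b, k < m)
    (hdisj : ∀ X, IsSignVector S X → ∀ k ∈ K X true, k ∉ K X false)
    (hsmall : ∀ X, IsSignVector S X → K X true ∪ K X false = ∅ → X.card ≤ r) :
    S.card ≤ r + m := by
  classical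
  rcases S.eq_empty_or_nonempty with rfl | ⟨v, -⟩
  · simp
  have : Nonempty α := ⟨v⟩
  let U : Finset (α × Bool) → Set ℕ := fun X => K X true ∪ K X false
  -- The chosen element depends only on the support, so antipodal vectors share it and see opposite
  -- signs there.
  let pt : Finset (α × Bool) → α := fun X => Classical.epsilon (· ∈ X.image Prod.fst)
  -- Sizes, lowered by one, use the numbers below `r`; colours use `r, …, r + m - 1`.
  let L : Finset (α × Bool) → Label := fun X =>
    if (U X).Nonempty then toLex (r + sSup (U X), decide (sSup (U X) ∈ K X true))
    else toLex (X.card - 1, decide ((pt X, true) ∈ X))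
  have hLpos : ∀ X, (U X).Nonempty →
      L X = toLex (r + sSup (U X), decide (sSup (U X) ∈ K X true)) := fun X h => if_pos h
  have hLneg : ∀ X, ¬ (U X).Nonempty →
      L X = toLex (X.card - 1, decide ((pt X, true) ∈ X)) := fun X h => if_neg h
  have hUlt : ∀ X, ∀ k ∈ U X, k < m := fun X k hk => hk.elim (hlt X _ k) (hlt X _ k)
  have hUsup : ∀ X, (U X).Nonempty → sSup (U X) ∈ U X := fun X h =>
    Nat.sSup_mem h ⟨m, fun k hk => (hUlt X k hk).le⟩
  have hUflip : ∀ X, U (X.image signFlip) = U X := by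
    intro X
    simp only [U, hflip, Bool.not_true, Bool.not_false]
    exact Set.union_comm _ _
  have hcard : ∀ X, IsSignVector S X → ¬ (U X).Nonempty → X.card - 1 < r := by
    intro X hX h
    have h1 := hsmall X hX (Set.not_nonempty_iff_eq_empty.1 h)
    have h2 := hX.nonempty.card_pos
    omega
  have hpt : ∀ X, IsSignVector S X → ((pt X, true) ∈ X ↔ (pt X, false) ∉ X) := by
    intro X hX
    have h : pt X ∈ X.image Prod.fst :=
      Classical.epsilon_spec (p := (· ∈ X.image Prod.fst)) (hX.nonempty.image _)
    obtain ⟨⟨a, b⟩, hab, hb⟩ := Finset.mem_image.1 h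
    change a = pt X at hb
    rw [hb] at hab
    constructor
    · intro h1 h2
      have := hX.injOn h1 h2 rfl
      simp at this
    · intro h1
      cases b
      · exact absurd hab h1
      · exact hab
  refine card_le_of_index_lt S L (r + m) ?_ ?_ ?_
  · intro X hX
    by_cases h : (U X).Nonempty
    · rw [hLpos _ (by rwa [hUflip]), hLpos _ h, hUflip]
      refine congrArg toLex (Prod.ext rfl ?_)
      change decide _ = !decide _
      rw [← decide_not, decide_eq_decide, hflip]
      exact ⟨fun h1 h2 => hdisj X hX _ h2 h1, fun h1 => (hUsup X h).resolve_left h1⟩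
    · rw [hLneg _ (by rwa [hUflip]), hLneg _ h]
      have hp : pt (X.image signFlip) = pt X := by
        simp only [pt, Finset.image_image]
        rfl
      refine congrArg toLex (Prod.ext ?_ ?_)
      · change _ - 1 = _ - 1
        rw [Finset.card_image_of_injective _ signFlip_injective]
      · change decide _ = !decide _
        rw [← decide_not, decide_eq_decide, hp, hpt X hX, not_not]
        exact mem_image_signFlip
  · intro X Y hX hY hXY hXYL
    have h1 := congrArg Label.index hXYL
    have h2 := congrArg Label.sign hXYL
    change (L X).index = (L Y).index at h1
    change (L X).sign = !(L Y).sign at h2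
    by_cases hUX : (U X).Nonempty <;> by_cases hUY : (U Y).Nonempty
    · rw [hLpos _ hUX, hLpos _ hUY] at h1 h2
      have h1 : sSup (U X) = sSup (U Y) := Nat.add_left_cancel h1
      change decide _ = !decide _ at h2
      rw [← decide_not, decide_eq_decide, ← h1] at h2
      -- By monotonicity the common largest colour lies on the same side in `X` and `Y`, so the
      -- signs agree.
      rcases hUsup X hUX with h | h
      · exact h2.1 h (hmono X Y _ hXY h)
      · exact hdisj X hX _ (h2.2 fun h' => hdisj Y hY _ h' (hmono X Y _ hXY h)) h
    · rw [hLpos _ hUX, hLneg _ hUY] at h1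
      have := hcard Y hY hUY
      change r + _ = Y.card - 1 at h1
      omega
    · rw [hLneg _ hUX, hLpos _ hUY] at h1
      have := hcard X hX hUX
      change X.card - 1 = r + _ at h1
      omega
    · rw [hLneg _ hUX, hLneg _ hUY] at h1
      change X.card - 1 = Y.card - 1 at h1
      have h3 := hX.nonempty.card_pos
      have h4 := hY.nonempty.card_pos
      have h5 : X = Y := Finset.eq_of_subset_of_card_le hXY (by omega)
      rw [h5] at h2
      revert h2
      cases (L Y).sign <;> decide
  · intro X hX
    by_cases h : (U X).Nonempty
    · rw [hLpos _ h]
      exact Nat.add_lt_add_left (hUlt X _ (hUsup X h)) r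
    · rw [hLneg _ h]
      exact (hcard X hX h).trans_le (Nat.le_add_right _ _)

/-! ### Application to the Kneser graph -/

/-- If the positive and the negative part of a sign vector contain no nonempty edge, then its zero
set meets the requirement in the definition of the colourability defect. -/
theorem colorabilityDefect_add_card_le {α : Type*} {H : Hypergraph α}
    {S : Finset α} (hS : (S : Set α) = H.vertexSet) {X : Finset (α × Bool)} (hX : IsSignVector S X)
    (h : ∀ b, ∀ e ∈ H.edgeSet, e.Nonempty → ¬ e ⊆ {v | (v, b) ∈ X}) :
    colorabilityDefect H + X.card ≤ S.card := by
  classical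
  have hsub : X.image Prod.fst ⊆ S := Finset.image_subset_iff.2 hX.fst_mem
  have hcard : (X.image Prod.fst).card = X.card := Finset.card_image_of_injOn hX.injOn
  have hle : colorabilityDefect H ≤ (S \ X.image Prod.fst).card := by
    refine Nat.sInf_le ⟨S \ X.image Prod.fst, ?_, rfl,
      fun v => if (v, true) ∈ X then 1 else 0, ?_⟩
    · rw [← hS]
      exact Finset.coe_subset.2 Finset.sdiff_subset
    · rintro e ⟨he, heX⟩ ⟨hne, k, hk⟩
      have hmem : ∀ v ∈ e, (v, true) ∈ X ∨ (v, false) ∈ X := by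
        intro v hv
        have hv' := heX hv
        rw [← hS, ← Finset.coe_sdiff, Finset.sdiff_sdiff_eq_self hsub, Finset.mem_coe,
          Finset.mem_image] at hv'
        obtain ⟨⟨w, b⟩, hw, rfl⟩ := hv'
        cases b
        · exact Or.inr hw
        · exact Or.inl hw
      by_cases hk1 : k = 1
      · refine h true e he hne fun v hv => ?_
        by_contra hv'
        change ¬ (v, true) ∈ X at hv'
        have : (if (v, true) ∈ X then 1 else 0 : Fin 2) = k := hk v hv
        rw [if_neg hv', hk1] at this
        exact absurd this (by decide)
      · refine h false e he hne fun v hv => (hmem v hv).resolve_left fun hv' => hk1 ?_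
        rw [← hk v hv]
        exact if_pos hv'
  rw [Finset.card_sdiff_of_subset hsub, hcard] at hle
  have := Finset.card_le_card hsub
  omega

theorem colorabilityDefect_le_of_colorable {α : Type*} (H : Hypergraph α)
    (hV : H.vertexSet.Finite) (m : ℕ) (hm : (generalizedKneserGraph H).Colorable m) :
    colorabilityDefect H ≤ m := by
  classical
  obtain ⟨C⟩ := hm
  have hS : (hV.toFinset : Set α) = H.vertexSet := hV.coe_toFinset
  -- Needed because `r` below is a truncated subtraction.
  have hd : colorabilityDefect H ≤ hV.toFinset.card := by
    obtain ⟨R, hR, hcard, -⟩ := colorabilityDefect_mem H hV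
    rw [← hcard]
    exact Finset.card_le_card (Finset.coe_subset.1 (hR.trans_eq hS.symm))
  have key := card_le_of_colour_sets hV.toFinset (hV.toFinset.card - colorabilityDefect H) m
    (fun X b => {k | ∃ e : H.edgeSet, (e : Set α).Nonempty ∧ (e : Set α) ⊆ {v | (v, b) ∈ X} ∧
      (C e : ℕ) = k}) ?_ ?_ ?_ ?_ ?_
  · omega
  · intro X b
    simp only [mem_image_signFlip]
  · rintro X Y b hXY k ⟨e, he, heX, hk⟩
    exact ⟨e, he, fun v hv => hXY (heX hv), hk⟩
  · rintro X b k ⟨e, -, -, rfl⟩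
    exact (C e).2
  · rintro X hX k ⟨e, he, heX, hek⟩ ⟨f, -, hfX, hfk⟩
    have hef : (e : Set α) ∩ (f : Set α) = ∅ := by
      refine Set.eq_empty_of_forall_notMem fun v hv => ?_
      have := hX.injOn (heX hv.1) (hfX hv.2) rfl
      simp at this
    refine C.valid (v := e) (w := f) ⟨?_, hef⟩ (Fin.ext (hek.trans hfk.symm))
    -- Adjacency also demands distinct edges; an edge disjoint from itself would be empty, which is
    -- why only nonempty edges count.
    rintro rfl
    rw [Set.inter_self] at hef
    exact he.ne_empty hef
  · intro X hX hK
    have := colorabilityDefect_add_card_le hS hX fun b e he hne heX => by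
      have h : (C ⟨e, he⟩ : ℕ) ∈ (∅ : Set ℕ) := by
        rw [← hK]
        cases b
        · exact Or.inr ⟨⟨e, he⟩, hne, heX, rfl⟩
        · exact Or.inl ⟨⟨e, he⟩, hne, heX, rfl⟩
      exact h
    omega

end KneserHypergraph

theorem mainTheorem5 {α : Type*} (H : Hypergraph α) (hV : H.vertexSet.Finite) :
    (KneserHypergraph.colorabilityDefect H : ℕ∞) ≤
      (KneserHypergraph.generalizedKneserGraph H).chromaticNumber := by
  refine SimpleGraph.le_chromaticNumber_iff_colorable.2 fun m hm => ?_
  exact_mod_cast KneserHypergraph.colorabilityDefect_le_of_colorable H hV m hm
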